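/- Let $C^\infty(\mathbb R,\mathbb R)$ carry its usual Fréchet topology (uniform convergence on compact sets of all derivatives), and let $\varphi\colon C^\infty(\mathbb R,\mathbb R)\to C^\infty(\mathbb R,\mathbb R)$ be a smooth map: all iterated directional derivatives $D^m\varphi(\sigma)(\tau_1,\dots,\tau_m)$ exist and are jointly continuous in $(\sigma,\tau_1,\dots,\tau_m)$. Suppose that $\varphi$ is - local: $\operatorname{supp}\varphi(f)\subset\operatorname{supp} f$ for all $f$; and - affine equivariant: $\varphi(g\cdot f)=g\cdot\varphi(f)$ for all $f$ and all $g=(a,b)$ with $a\in\mathbb R\setminus\{0\}$, $b\in\mathbb R$, where $(g\cdot f)(x)=a\,f(a^{-1}(x-b))$. Then the Taylor development of $\varphi$ at the zero vector field is a B-series: there are coefficients $b(t)\in\mathbb R$, indexed by the isomorphism classes of (non-empty, finite) rooted trees $t$, such that for every $m\ge 0$ and every $f\in C^\infty(\mathbb R,\mathbb R)$ $$\frac1{m!}\,D^m\varphi(0)(f,\dots,f)=\sum_{|t|=m} b(t)\,F(t)(f),$$ where $|t|$ is the number of nodes of $t$ and $F(t)(f)$ is the elementary differential of $t$ (for $m=0$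 the right-hand side is $0$). Moreover, in dimension one, for every aromatic tree $\gamma$ (a directed finite graph with $n$ nodes and $n-1$ arrows in which each node has at most one outgoing arrow) the elementary differential depends only on the composition $\kappa$ of $\gamma$, where $\kappa(j)$ is the number of nodes with exactly $j$ incoming arrows: $$F(\gamma)(f)=\prod_{j\ge 0}\bigl(f^{(j)}\bigr)^{\kappa(j)}.$$ Here $F(\gamma)(f)$ is obtained by labelling the nodes with coordinate indices, taking for each node with label $j$ the factor $f^{j}_{i_1\dots i_r}=\partial_{i_1}\cdots\partial_{i_r}f^j$, where $i_1,\dots,i_r$ are the labels of the nodes pointing to it, and summing the product over all labels except that of the root; rooted trees, with arrows pointing to the root, are the aromatic trees without cycles. -/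

import Mathlib

open scoped ContDiff Manifold Topology

/-! ### The Fréchet space of smooth functions on the line -/

/-- The vector space `C^∞(ℝ, ℝ)`, whose elements are also the smooth vector fields on the line. -/
abbrev SmoothFun : Type := C^∞⟮𝓘(ℝ, ℝ), ℝ; 𝓘(ℝ, ℝ), ℝ⟯

namespace SmoothFun

theorem contDiff (f : SmoothFun) : ContDiff ℝ ∞ f := f.contMDiff.contDiff

/-- The `k`-th derivative of a smooth function, as a continuous function. -/
noncomputable def derivC (k : ℕ) (f : SmoothFun) : C(ℝ, ℝ) where
  toFun := iteratedDeriv k f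
  continuous_toFun := f.contDiff.continuous_iteratedDeriv k (by exact_mod_cast le_top)

/-- The usual Fréchet topology of `C^∞(ℝ, ℝ)`: uniform convergence on compact sets of the function
and of each of its derivatives. -/
noncomputable instance : TopologicalSpace SmoothFun :=
  ⨅ k : ℕ, TopologicalSpace.induced (derivC k) ContinuousMap.compactOpen

/-- The action of the affine map `x ↦ a x + b` on vector fields,
`((a, b) • f) x = a f (a⁻¹ (x - b))`. -/
noncomputable def affineAct (a : ℝˣ) (b : ℝ) (f : SmoothFun) : SmoothFun :=
  ⟨fun x => (a : ℝ) * f ((a : ℝ)⁻¹ * (x - b)), by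
    apply ContDiff.contMDiff
    have := f.contDiff
    fun_prop⟩

/-- Equivariance under the affine group `GL(1) ⋉ ℝ` of the line. -/
def IsAffineEquivariant (φ : SmoothFun → SmoothFun) : Prop :=
  ∀ (a : ℝˣ) (b : ℝ) (f : SmoothFun), φ (affineAct a b f) = affineAct a b (φ f)

/-- Locality: the map does not increase supports. -/
def IsLocal (φ : SmoothFun → SmoothFun) : Prop :=
  ∀ f : SmoothFun, tsupport (φ f) ⊆ tsupport f

end SmoothFun

/-! ### Smooth maps between Fréchet spaces -/

section Smooth

variable {E F : Type*} [AddCommGroup E] [Module ℝ E] [TopologicalSpace E]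
  [AddCommGroup F] [Module ℝ F] [TopologicalSpace F]

/-- The difference quotient `(φ (σ + ε τ) - φ σ) / ε`. -/
noncomputable def diffQuotient (φ : E → F) (σ τ : E) (ε : ℝ) : F :=
  ε⁻¹ • (φ (σ + ε • τ) - φ σ)

/-- The iterated derivative `⟨D^m φ(σ), (τ₀, …, τ_{m-1})⟩`, obtained by differentiating `m` times
in the directions `τ₀`, …, `τ_{m-1}`, in this order. -/
noncomputable def frechetIterDeriv (φ : E → F) : (m : ℕ) → E → (Fin m → E) → F
  | 0, σ, _ => φ σ
  | m + 1, σ, τ =>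
      haveI : Nonempty F := ⟨0⟩
      Filter.limUnder (𝓝[≠] (0 : ℝ))
        (diffQuotient (fun σ' => frechetIterDeriv φ m σ' (Fin.init τ)) σ (τ (Fin.last m)))

/-- Smoothness of a map between Fréchet spaces: for every `m` the limits that define the derivative
of order `m + 1` exist, and `(σ, τ₀, …, τ_{m-1}) ↦ ⟨D^m φ(σ), (τ₀, …, τ_{m-1})⟩` is continuous. -/
def IsFrechetSmooth (φ : E → F) : Prop :=
  ∀ m : ℕ,
    (∀ (σ : E) (τ : Fin (m + 1) → E),
      Filter.Tendsto
        (diffQuotient (fun σ' => frechetIterDeriv φ m σ' (Fin.init τ)) σ (τ (Fin.last m)))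
        (𝓝[≠] (0 : ℝ)) (𝓝 (frechetIterDeriv φ (m + 1) σ τ))) ∧
    Continuous (fun p : E × (Fin m → E) => frechetIterDeriv φ m p.1 p.2)

/-- The homogeneous term of order `m` in the Taylor development of `φ` at zero,
`f ↦ (1 / m!) ⟨D^m φ(0), (f, …, f)⟩`. -/
noncomputable def taylorTerm (φ : E → F) (m : ℕ) (f : E) : F :=
  ((m.factorial : ℝ)⁻¹) • frechetIterDeriv φ m 0 (fun _ => f)

end Smooth

/-! ### Aromatic forests, aromatic trees, rooted trees -/

/-- An aromatic forest with node set `Fin n`: a directed graph with at most one outgoing edge from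
each node. There is an edge from `u` to `v` exactly when `γ u = some v`. -/
abbrev AromaticForest (n : ℕ) : Type := Fin n → Option (Fin n)

namespace AromaticForest

variable {n : ℕ}

/-- The set of arrows, each identified with its source. -/
def arrows (γ : AromaticForest n) : Finset (Fin n) :=
  Finset.univ.filter fun u => (γ u).isSome

/-- An aromatic tree is an aromatic forest with `n` nodes and `n - 1` arrows. -/
def IsAromaticTree (γ : AromaticForest n) : Prop := γ.arrows.card + 1 = n

/-- A rooted tree is an aromatic tree without cycles; the edges point towards the root. -/
def IsRootedTree (γ : AromaticForest n) : Prop :=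
  γ.IsAromaticTree ∧ ∀ v, ¬ Relation.TransGen (fun u w => γ u = some w) v v

/-- The nodes that point towards `v`. -/
def parents (γ : AromaticForest n) (v : Fin n) : Finset (Fin n) :=
  Finset.univ.filter fun u => γ u = some v

/-- The composition `κ` of an aromatic forest: `κ j` is the number of nodes with `j` parents. -/
def composition (γ : AromaticForest n) (j : ℕ) : ℕ :=
  (Finset.univ.filter fun v => (γ.parents v).card = j).card

/-- Isomorphism of directed graphs. -/
def Iso (γ δ : AromaticForest n) : Prop :=
  ∃ s : Equiv.Perm (Fin n), ∀ u, δ (s u) = (γ u).map s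

variable {E ι : Type*} [NormedAddCommGroup E] [NormedSpace ℝ E] [Fintype ι]

/-- The factor `f^{ℓ(v)}_{ℓ(u₁) … ℓ(u_j)}` of the node `v`, where `u₁, …, u_j` are the nodes that
point towards `v` and `ℓ` is a labelling of the nodes with coordinate indices. -/
noncomputable def nodeFactor (e : Module.Basis ι ℝ E) (γ : AromaticForest n) (f : E → E) (x : E)
    (ℓ : Fin n → ι) (v : Fin n) : ℝ :=
  e.coord (ℓ v) (iteratedFDeriv ℝ (γ.parents v).card f x
    fun i => e (ℓ ((γ.parents v).orderEmbOfFin rfl i)))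

open Classical in
/-- The elementary differential of an aromatic tree with respect to a vector field `f` on a
finite-dimensional space with coordinates given by a basis `e`. The component of index `k` is the
sum over all labellings for which the root has the label `k`. -/
noncomputable def elementaryDifferential (e : Module.Basis ι ℝ E) (γ : AromaticForest n)
    (f : E → E) (x : E) : E :=
  ∑ k : ι, (∑ ℓ : Fin n → ι with ∀ v, γ v = none → ℓ v = k,
    ∏ v, γ.nodeFactor e f x ℓ v) • e k

end AromaticForest

/-- Isomorphism is an equivalence relation on the rooted trees with node set `Fin n`. -/
def rootedTreeSetoid (n : ℕ) : Setoid {γ : AromaticForest n // γ.IsRootedTree} where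
  r γ δ := γ.1.Iso δ.1
  iseqv :=
    { refl := fun γ => ⟨1, fun u => by simp⟩
      symm := by
        rintro γ δ ⟨s, hs⟩
        refine ⟨s.symm, fun u => ?_⟩
        have := hs (s.symm u)
        rw [Equiv.apply_symm_apply] at this
        rw [this, Option.map_map]
        simp
      trans := by
        rintro γ δ η ⟨s, hs⟩ ⟨t, ht⟩
        refine ⟨s.trans t, fun u => ?_⟩
        rw [Equiv.trans_apply, ht, hs, Option.map_map]
        rfl }

/-- Rooted trees with `n` nodes, up to isomorphism. -/
def ButcherTree (n : ℕ) : Type := Quotient (rootedTreeSetoid n)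

namespace ButcherTree

noncomputable instance (n : ℕ) : Fintype (ButcherTree n) :=
  haveI : Finite (ButcherTree n) := inferInstanceAs (Finite (Quotient (rootedTreeSetoid n)))
  Fintype.ofFinite _

end ButcherTree

/-- The standard coordinate on the line. -/
noncomputable def lineBasis : Module.Basis Unit ℝ ℝ := Module.Basis.singleton Unit ℝ

namespace AromaticForest

variable {n : ℕ}

theorem Iso.nodeFactor_eq {γ δ : AromaticForest n} {s : Equiv.Perm (Fin n)}
    (hs : ∀ u, δ (s u) = (γ u).map s) (f : ℝ → ℝ) (x : ℝ) (ℓ : Fin n → Unit) (v : Fin n) :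
    δ.nodeFactor lineBasis f x ℓ (s v) = γ.nodeFactor lineBasis f x (ℓ ∘ s) v := by
  have hcard : (δ.parents (s v)).card = (γ.parents v).card := by
    symm
    refine Finset.card_equiv s fun u => ?_
    simp only [parents, Finset.mem_filter, Finset.mem_univ, true_and]
    rw [hs]
    simp
  have key : ∀ (p q : ℕ), p = q → iteratedFDeriv ℝ p f x (fun _ => lineBasis ()) =
      iteratedFDeriv ℝ q f x (fun _ => lineBasis ()) := by
    rintro p _ rfl
    rfl
  exact congrArg (lineBasis.coord ()) (key _ _ hcard)

theorem Iso.elementaryDifferential_eq {γ δ : AromaticForest n} (h : γ.Iso δ) (f : ℝ → ℝ) :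
    γ.elementaryDifferential lineBasis f = δ.elementaryDifferential lineBasis f := by
  obtain ⟨s, hs⟩ := h
  funext x
  unfold elementaryDifferential
  refine Finset.sum_congr rfl fun k _ => ?_
  congr 1
  symm
  refine Finset.sum_equiv (Equiv.arrowCongr s.symm (Equiv.refl Unit)) (fun ℓ => ?_) (fun ℓ _ => ?_)
  · simp
  · rw [← Equiv.prod_comp s]
    refine Finset.prod_congr rfl fun v _ => ?_
    rw [Iso.nodeFactor_eq hs f]
    rfl

end AromaticForest

/-- The elementary differential of a rooted tree with respect to a vector field on the line. -/
noncomputable def ButcherTree.elementaryDifferential {n : ℕ} (t : ButcherTree n) (f : ℝ → ℝ) :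
    ℝ → ℝ :=
  Quotient.lift (fun γ => γ.1.elementaryDifferential lineBasis f)
    (fun _ _ h => AromaticForest.Iso.elementaryDifferential_eq h f) t

/-- A sequence of homogeneous terms is (the sequence of terms of) a B-series, if there are
coefficients `b` on the rooted trees such that the term of order `m` is
`∑_{|t| = m} b(t) F(t)(f)`. -/
def IsBSeries (T : ℕ → SmoothFun → SmoothFun) : Prop :=
  ∃ b : (m : ℕ) → ButcherTree m → ℝ, ∀ (m : ℕ) (f : SmoothFun) (x : ℝ),
    T m f x = ∑ t : ButcherTree m, b m t * t.elementaryDifferential f x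

/-! ### Hadamard's lemma -/

/-- Differentiation under the integral in the averages `∫₀¹ t ^ j g (t x) dt`. -/
theorem hasDerivAt_integral_pow_mul_comp_mul {g : ℝ → ℝ} (hg : ContDiff ℝ 1 g) (j : ℕ) (x : ℝ) :
    HasDerivAt (fun x => ∫ t in (0 : ℝ)..1, t ^ j * g (t * x))
      (∫ t in (0 : ℝ)..1, t ^ (j + 1) * deriv g (t * x)) x := by
  have hg0 : Continuous g := hg.continuous
  have hg1 : Continuous (deriv g) := hg.continuous_deriv le_rfl
  have hcont : Continuous (fun p : ℝ × ℝ => p.2 ^ (j + 1) * deriv g (p.2 * p.1)) := by fun_prop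
  obtain ⟨C, hC⟩ := ((isCompact_closedBall x 1).prod (isCompact_Icc (a := (0 : ℝ)) (b := 1))
    ).exists_bound_of_continuousOn hcont.continuousOn
  refine (intervalIntegral.hasDerivAt_integral_of_dominated_loc_of_deriv_le
    (F := fun x t => t ^ j * g (t * x)) (F' := fun x t => t ^ (j + 1) * deriv g (t * x))
    (bound := fun _ => C) (Metric.closedBall_mem_nhds x one_pos) ?_ ?_ ?_ ?_ ?_ ?_).2
  · exact Filter.Eventually.of_forall fun y =>
      (show Continuous fun t : ℝ => t ^ j * g (t * y) by fun_prop).aestronglyMeasurable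
  · exact (show Continuous fun t : ℝ => t ^ j * g (t * x) by fun_prop).intervalIntegrable _ _
  · exact (show Continuous fun t : ℝ => t ^ (j + 1) * deriv g (t * x) by
      fun_prop).aestronglyMeasurable
  · refine Filter.Eventually.of_forall fun t ht y hy => ?_
    rw [Set.uIoc_of_le zero_le_one] at ht
    exact hC (y, t) ⟨hy, ht.1.le, ht.2⟩
  · exact intervalIntegrable_const
  · refine Filter.Eventually.of_forall fun t _ y _ => ?_
    have h1 : HasDerivAt g (deriv g (t * y)) (t * y) :=
      (hg.differentiable one_ne_zero).differentiableAt.hasDerivAt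
    have h2 : HasDerivAt (fun y => t * y) t y := by simpa using (hasDerivAt_id y).const_mul t
    have h3 := (h1.comp y h2).const_mul (t ^ j)
    exact h3.congr_deriv (by ring)

theorem iteratedDeriv_integral_comp_mul {g : ℝ → ℝ} (hg : ContDiff ℝ ∞ g) (j : ℕ) :
    iteratedDeriv j (fun x => ∫ t in (0 : ℝ)..1, g (t * x)) =
      fun x => ∫ t in (0 : ℝ)..1, t ^ j * iteratedDeriv j g (t * x) := by
  induction j with
  | zero => simp
  | succ j ih =>
    rw [iteratedDeriv_succ, ih]
    funext x
    rw [iteratedDeriv_succ]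
    refine (hasDerivAt_integral_pow_mul_comp_mul ?_ j x).deriv
    rw [iteratedDeriv_eq_iterate]
    exact (hg.iterate_deriv j).of_le (by exact_mod_cast le_top)

theorem contDiff_integral_comp_mul {g : ℝ → ℝ} (hg : ContDiff ℝ ∞ g) :
    ContDiff ℝ ∞ (fun x => ∫ t in (0 : ℝ)..1, g (t * x)) := by
  refine contDiff_of_differentiable_iteratedDeriv fun j _ => ?_
  rw [iteratedDeriv_integral_comp_mul hg]
  refine fun x => (hasDerivAt_integral_pow_mul_comp_mul ?_ j x).differentiableAt
  rw [iteratedDeriv_eq_iterate]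
  exact (hg.iterate_deriv j).of_le (by exact_mod_cast le_top)

/-- **Hadamard's lemma**: Taylor's formula at zero with a smooth remainder. -/
theorem exists_contDiff_taylor_remainder (N : ℕ) {f : ℝ → ℝ} (hf : ContDiff ℝ ∞ f) :
    ∃ r : ℝ → ℝ, ContDiff ℝ ∞ r ∧ ∀ x, f x =
      ∑ k ∈ Finset.range N, iteratedDeriv k f 0 / k.factorial * x ^ k + x ^ N * r x := by
  induction N generalizing f with
  | zero => exact ⟨f, hf, fun x => by simp⟩
  | succ N ih =>
    have hd : ContDiff ℝ ∞ (deriv f) := (contDiff_infty_iff_deriv.1 hf).2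
    obtain ⟨r, hr, h⟩ := ih (contDiff_integral_comp_mul hd)
    refine ⟨r, hr, fun x => ?_⟩
    have h0 : f x = f 0 + x * ∫ t in (0 : ℝ)..1, deriv f (t * x) := by
      have hd' : ∀ t ∈ Set.uIcc (0 : ℝ) 1,
          HasDerivAt (fun t => f (t * x)) (deriv f (t * x) * x) t := fun t _ => by
        have h1 : HasDerivAt f (deriv f (t * x)) (t * x) :=
          (hf.differentiable (by simp)).differentiableAt.hasDerivAt
        have h2 : HasDerivAt (fun t => t * x) x t := by simpa using (hasDerivAt_id t).mul_const x
        exact h1.comp t h2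
      have hc : Continuous (deriv f) := hd.continuous
      have := intervalIntegral.integral_eq_sub_of_hasDerivAt hd'
        ((show Continuous fun t : ℝ => deriv f (t * x) * x by fun_prop).intervalIntegrable _ _)
      rw [intervalIntegral.integral_mul_const] at this
      simp only [one_mul, zero_mul] at this
      linarith
    rw [h0, h x, Finset.sum_range_succ', mul_add, Finset.mul_sum]
    have hk : ∀ k ∈ Finset.range N,
        x * (iteratedDeriv k (fun x => ∫ t in (0 : ℝ)..1, deriv f (t * x)) 0 / k.factorial * x ^ k)
          = iteratedDeriv (k + 1) f 0 / (k + 1).factorial * x ^ (k + 1) := fun k _ => by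
      rw [iteratedDeriv_integral_comp_mul hd, iteratedDeriv_succ']
      simp only [mul_zero, intervalIntegral.integral_mul_const, integral_pow]
      rw [Nat.factorial_succ]
      have := k.factorial_ne_zero
      push_cast
      field_simp
      simp
      ring
    rw [Finset.sum_congr rfl hk]
    simp
    ring

/-! ### The topology of the space of smooth functions -/

namespace SmoothFun

theorem continuous_apply (x : ℝ) : Continuous fun f : SmoothFun => f x := by
  have h0 : Continuous (derivC 0) := continuous_iff_le_induced.2 (iInf_le _ 0)
  have := (continuous_eval_const (F := C(ℝ, ℝ)) x).comp h0
  refine this.congr fun f => ?_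
  simp [derivC]

/-- The iterated partial derivative in the second variable of a jointly smooth function is jointly
smooth. -/
theorem contDiff_iteratedDeriv_snd {P : Type*} [NormedAddCommGroup P] [NormedSpace ℝ P]
    {F : P × ℝ → ℝ} (hF : ContDiff ℝ ∞ F) (k : ℕ) :
    ContDiff ℝ ∞ fun q : P × ℝ => iteratedDeriv k (fun x => F (q.1, x)) q.2 := by
  induction k with
  | zero => simpa using hF
  | succ k ih =>
    have h : (fun q : P × ℝ => iteratedDeriv (k + 1) (fun x => F (q.1, x)) q.2) = fun q =>
        fderiv ℝ (fun q : P × ℝ => iteratedDeriv k (fun x => F (q.1, x)) q.2) q (0, 1) := by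
      funext q
      rw [iteratedDeriv_succ]
      have h1 := ((ih.differentiable (by simp)) q).hasFDerivAt
      have h2 : HasDerivAt (fun x : ℝ => (q.1, x)) (0, 1) q.2 :=
        (hasDerivAt_const q.2 q.1).prodMk (hasDerivAt_id q.2)
      exact (h1.comp_hasDerivAt q.2 h2).deriv
    rw [h]
    exact (ih.fderiv_right (by simp)).clm_apply contDiff_const

/-- A jointly smooth family of smooth functions is continuous for the Fréchet topology. -/
theorem continuous_of_contDiff {P : Type*} [NormedAddCommGroup P] [NormedSpace ℝ P]
    {F : P × ℝ → ℝ} (hF : ContDiff ℝ ∞ F) {Φ : P → SmoothFun} (hΦ : ∀ p x, Φ p x = F (p, x)) :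
    Continuous Φ := by
  refine continuous_iInf_rng.2 fun k => continuous_induced_rng.2 ?_
  refine ContinuousMap.continuous_of_continuous_uncurry _ ?_
  refine (contDiff_iteratedDeriv_snd hF k).continuous.congr fun q => ?_
  have : (Φ q.1 : ℝ → ℝ) = fun x => F (q.1, x) := funext (hΦ q.1)
  simp [derivC, Function.uncurry, this]

end SmoothFun

/-! ### Iterated directional derivatives as multilinear forms -/

namespace SmoothFun

variable {φ : SmoothFun → SmoothFun}

theorem hasDerivAt_frechetIterDeriv (hφ : IsFrechetSmooth φ) (m : ℕ) (σ v : SmoothFun)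
    (τ : Fin m → SmoothFun) (x s : ℝ) :
    HasDerivAt (fun t : ℝ => frechetIterDeriv φ m (σ + t • v) τ x)
      (frechetIterDeriv φ (m + 1) (σ + s • v) (Fin.snoc (α := fun _ => SmoothFun) τ v) x) s := by
  rw [hasDerivAt_iff_tendsto_slope_zero]
  have h := ((continuous_apply x).tendsto _).comp
    ((hφ m).1 (σ + s • v) (Fin.snoc (α := fun _ => SmoothFun) τ v))
  refine h.congr fun t => ?_
  simp [diffQuotient, Fin.init_snoc (α := fun _ => SmoothFun), add_smul, add_assoc]

theorem continuous_frechetIterDeriv_apply (hφ : IsFrechetSmooth φ) (m : ℕ) (x : ℝ)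
    {P : Type*} [TopologicalSpace P] {σ : P → SmoothFun} {τ : P → Fin m → SmoothFun}
    (hσ : Continuous σ) (hτ : Continuous τ) :
    Continuous fun p => frechetIterDeriv φ m (σ p) (τ p) x :=
  (continuous_apply x).comp ((hφ m).2.comp (hσ.prodMk hτ))

theorem continuous_add_smul_add_smul (σ u v : SmoothFun) :
    Continuous fun p : ℝ × ℝ => σ + p.1 • u + p.2 • v := by
  have h0 := σ.contDiff
  have h1 := u.contDiff
  have h2 := v.contDiff
  exact continuous_of_contDiff
    (F := fun q : (ℝ × ℝ) × ℝ => σ q.2 + q.1.1 * u q.2 + q.1.2 * v q.2)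
    (by fun_prop) (fun p x => by simp)

theorem frechetIterDeriv_snoc_add (hφ : IsFrechetSmooth φ) (m : ℕ) (σ u v : SmoothFun)
    (τ : Fin m → SmoothFun) (x : ℝ) :
    frechetIterDeriv φ (m + 1) σ (Fin.snoc (α := fun _ => SmoothFun) τ (u + v)) x =
      frechetIterDeriv φ (m + 1) σ (Fin.snoc (α := fun _ => SmoothFun) τ u) x +
        frechetIterDeriv φ (m + 1) σ (Fin.snoc (α := fun _ => SmoothFun) τ v) x := by
  have hc : ∀ w : SmoothFun, Continuous fun p : ℝ × ℝ => ContinuousLinearMap.toSpanSingleton ℝ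
      (frechetIterDeriv φ (m + 1) (σ + p.1 • u + p.2 • v)
        (Fin.snoc (α := fun _ => SmoothFun) τ w) x) := fun w =>
    (ContinuousLinearMap.toSpanSingletonCLE (𝕜 := ℝ) (E := ℝ)).continuous.comp
      (continuous_frechetIterDeriv_apply hφ (m + 1) x (continuous_add_smul_add_smul σ u v)
        continuous_const)
  have hG := hasStrictFDerivAt_uncurry_coprod (𝕜 := ℝ) (u := ((0 : ℝ), (0 : ℝ)))
    (f := fun s t : ℝ => frechetIterDeriv φ m (σ + s • u + t • v) τ x)
    (f₁ := fun s t => ContinuousLinearMap.toSpanSingleton ℝ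
      (frechetIterDeriv φ (m + 1) (σ + s • u + t • v) (Fin.snoc (α := fun _ => SmoothFun) τ u) x))
    (f₂ := fun s t => ContinuousLinearMap.toSpanSingleton ℝ
      (frechetIterDeriv φ (m + 1) (σ + s • u + t • v) (Fin.snoc (α := fun _ => SmoothFun) τ v) x))
    (Filter.Eventually.of_forall fun p => by
      have := (hasDerivAt_frechetIterDeriv hφ m (σ + p.2 • v) u τ x p.1).hasFDerivAt
      simpa only [add_right_comm σ] using! this)
    (Filter.Eventually.of_forall fun p =>
      (hasDerivAt_frechetIterDeriv hφ m (σ + p.1 • u) v τ x p.2).hasFDerivAt)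
    (hc u).continuousAt (hc v).continuousAt
  have hdiag : HasDerivAt (fun t : ℝ => (t, t)) ((1 : ℝ), (1 : ℝ)) 0 :=
    (hasDerivAt_id 0).prodMk (hasDerivAt_id 0)
  have h1 := HasFDerivAt.comp_hasDerivAt (f := fun t : ℝ => (t, t)) (0 : ℝ) hG.hasFDerivAt hdiag
  have h2 := hasDerivAt_frechetIterDeriv hφ m σ (u + v) τ x 0
  have h3 := h2.unique (h1.congr_of_eventuallyEq (Filter.Eventually.of_forall fun t => by
    simp [Function.HasUncurry.uncurry, add_assoc]))
  simpa [Function.HasUncurry.uncurry] using h3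

theorem frechetIterDeriv_snoc_smul (hφ : IsFrechetSmooth φ) (m : ℕ) (σ u : SmoothFun) (c : ℝ)
    (τ : Fin m → SmoothFun) (x : ℝ) :
    frechetIterDeriv φ (m + 1) σ (Fin.snoc (α := fun _ => SmoothFun) τ (c • u)) x =
      c * frechetIterDeriv φ (m + 1) σ (Fin.snoc (α := fun _ => SmoothFun) τ u) x := by
  have h1 := hasDerivAt_frechetIterDeriv hφ m σ (c • u) τ x 0
  have h2 := hasDerivAt_frechetIterDeriv hφ m σ u τ x (0 * c)
  have h3 : HasDerivAt (fun t : ℝ => t * c) c 0 := by simpa using (hasDerivAt_id (0 : ℝ)).mul_const c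
  have h4 := h1.unique ((h2.comp (0 : ℝ) h3).congr_of_eventuallyEq
    (Filter.Eventually.of_forall fun t => by simp [mul_smul]))
  simpa [mul_comm c] using h4

theorem frechetIterDeriv_update_add (hφ : IsFrechetSmooth φ) (m : ℕ) (σ : SmoothFun)
    (τ : Fin m → SmoothFun) (i : Fin m) (u v : SmoothFun) (x : ℝ) :
    frechetIterDeriv φ m σ (Function.update τ i (u + v)) x =
      frechetIterDeriv φ m σ (Function.update τ i u) x +
        frechetIterDeriv φ m σ (Function.update τ i v) x := by
  induction m generalizing σ with
  | zero => exact i.elim0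
  | succ m ih =>
    rw [← Fin.snoc_init_self τ]
    refine Fin.lastCases ?_ (fun i => ?_) i
    · simp only [Fin.update_snoc_last]
      exact frechetIterDeriv_snoc_add hφ m σ u v _ x
    · simp only [← Fin.snoc_update]
      have h := fun w => hasDerivAt_frechetIterDeriv hφ m σ (τ (Fin.last m))
        (Function.update (Fin.init τ) i w) x 0
      have := (h (u + v)).unique (((h u).add (h v)).congr_of_eventuallyEq
        (Filter.Eventually.of_forall fun t => ih _ _ _))
      simpa using this

theorem frechetIterDeriv_update_smul (hφ : IsFrechetSmooth φ) (m : ℕ) (σ : SmoothFun)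
    (τ : Fin m → SmoothFun) (i : Fin m) (c : ℝ) (u : SmoothFun) (x : ℝ) :
    frechetIterDeriv φ m σ (Function.update τ i (c • u)) x =
      c * frechetIterDeriv φ m σ (Function.update τ i u) x := by
  induction m generalizing σ with
  | zero => exact i.elim0
  | succ m ih =>
    rw [← Fin.snoc_init_self τ]
    refine Fin.lastCases ?_ (fun i => ?_) i
    · simp only [Fin.update_snoc_last]
      exact frechetIterDeriv_snoc_smul hφ m σ u c _ x
    · simp only [← Fin.snoc_update]
      have h := fun w => hasDerivAt_frechetIterDeriv hφ m σ (τ (Fin.last m))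
        (Function.update (Fin.init τ) i w) x 0
      have := (h (c • u)).unique (((h u).const_mul c).congr_of_eventuallyEq
        (Filter.Eventually.of_forall fun t => ih _ _ _))
      simpa using this

/-- The derivative of order `m` at the point `σ`, evaluated at `x`, as a multilinear form. -/
noncomputable def derivForm (hφ : IsFrechetSmooth φ) (m : ℕ) (σ : SmoothFun) (x : ℝ) :
    MultilinearMap ℝ (fun _ : Fin m => SmoothFun) ℝ :=
  MultilinearMap.mk' (fun τ => frechetIterDeriv φ m σ τ x)
    (fun τ i u v => frechetIterDeriv_update_add hφ m σ τ i u v x)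
    (fun τ i c u => frechetIterDeriv_update_smul hφ m σ τ i c u x)

theorem derivForm_apply (hφ : IsFrechetSmooth φ) (m : ℕ) (σ : SmoothFun) (x : ℝ)
    (τ : Fin m → SmoothFun) : derivForm hφ m σ x τ = frechetIterDeriv φ m σ τ x := rfl

/-! ### Equivariance of the derivatives -/

theorem affineAct_apply (a : ℝˣ) (b : ℝ) (f : SmoothFun) (x : ℝ) :
    affineAct a b f x = (a : ℝ) * f ((a : ℝ)⁻¹ * (x - b)) := rfl

theorem frechetIterDeriv_affineAct (hφ : IsFrechetSmooth φ) (he : IsAffineEquivariant φ)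
    (a : ℝˣ) (b : ℝ) (m : ℕ) (σ : SmoothFun) (τ : Fin m → SmoothFun) (x : ℝ) :
    frechetIterDeriv φ m (affineAct a b σ) (fun i => affineAct a b (τ i)) x =
      (a : ℝ) * frechetIterDeriv φ m σ τ ((a : ℝ)⁻¹ * (x - b)) := by
  induction m generalizing σ with
  | zero =>
    change φ (affineAct a b σ) x = _
    rw [he, affineAct_apply]
    rfl
  | succ m ih =>
    have h1 := hasDerivAt_frechetIterDeriv hφ m (affineAct a b σ) (affineAct a b (τ (Fin.last m)))
      (fun i => affineAct a b (Fin.init τ i)) x 0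
    have h2 := (hasDerivAt_frechetIterDeriv hφ m σ (τ (Fin.last m)) (Fin.init τ)
      ((a : ℝ)⁻¹ * (x - b)) 0).const_mul (a : ℝ)
    have hs : (Fin.snoc (α := fun _ => SmoothFun) (fun i => affineAct a b (Fin.init τ i))
        (affineAct a b (τ (Fin.last m)))) = fun i => affineAct a b (τ i) := by
      funext i
      refine Fin.lastCases ?_ (fun i => ?_) i <;> simp [Fin.init]
    have h3 := h1.unique (h2.congr_of_eventuallyEq (Filter.Eventually.of_forall fun t => by
      beta_reduce
      rw [← ih]
      congr 2
      ext y
      simp [affineAct_apply]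
      ring))
    rw [hs, Fin.snoc_init_self] at h3
    simpa using h3

end SmoothFun

/-! ### The Taylor terms of an affine equivariant map -/

namespace SmoothFun

variable {φ : SmoothFun → SmoothFun}

/-- The dilated function `x ↦ f (ε x)`. -/
noncomputable def dilate (ε : ℝ) (f : SmoothFun) : SmoothFun :=
  ⟨fun x => f (ε * x), by
    apply ContDiff.contMDiff
    have := f.contDiff
    fun_prop⟩

/-- The monomial `x ↦ x ^ k`. -/
noncomputable def monomial (k : ℕ) : SmoothFun :=
  ⟨fun x => x ^ k, by
    apply ContDiff.contMDiff
    fun_prop⟩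

theorem dilate_apply (ε : ℝ) (f : SmoothFun) (x : ℝ) : dilate ε f x = f (ε * x) := rfl

theorem monomial_apply (k : ℕ) (x : ℝ) : monomial k x = x ^ k := rfl

theorem dilate_monomial (ε : ℝ) (k : ℕ) : dilate ε (monomial k) = ε ^ k • monomial k := by
  ext x
  simp [dilate_apply, monomial_apply, mul_pow]

theorem derivForm_dilate (hφ : IsFrechetSmooth φ) (he : IsAffineEquivariant φ) (n : ℕ)
    {ε : ℝ} (hε : ε ≠ 0) (τ : Fin (n + 1) → SmoothFun) :
    derivForm hφ (n + 1) 0 0 (fun i => dilate ε (τ i)) = ε ^ n * derivForm hφ (n + 1) 0 0 τ := by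
  have h := frechetIterDeriv_affineAct hφ he (Units.mk0 ε⁻¹ (inv_ne_zero hε)) 0 (n + 1) 0 τ 0
  have h0 : affineAct (Units.mk0 ε⁻¹ (inv_ne_zero hε)) 0 0 = 0 := by
    ext x
    simp [affineAct_apply]
  have h1 : ∀ i, affineAct (Units.mk0 ε⁻¹ (inv_ne_zero hε)) 0 (τ i) = ε⁻¹ • dilate ε (τ i) := by
    intro i
    ext x
    simp [affineAct_apply, dilate_apply]
  simp only [h0, h1, ← derivForm_apply hφ] at h
  rw [MultilinearMap.map_smul_univ] at h
  simp only [Finset.prod_const, Finset.card_univ, Fintype.card_fin, Units.val_mk0, smul_eq_mul,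
    sub_self, mul_zero] at h
  rw [pow_succ, inv_pow, mul_assoc, mul_left_comm] at h
  have h2 := mul_left_cancel₀ (inv_ne_zero hε) h
  rw [inv_mul_eq_iff_eq_mul₀ (pow_ne_zero _ hε)] at h2
  exact h2

/-- Dilations force the form to vanish on monomials of the wrong total degree. -/
theorem derivForm_monomial_eq_zero (hφ : IsFrechetSmooth φ) (he : IsAffineEquivariant φ) (n : ℕ)
    {k : Fin (n + 1) → ℕ} (hk : ∑ i, k i ≠ n) :
    derivForm hφ (n + 1) 0 0 (fun i => monomial (k i)) = 0 := by
  have h := derivForm_dilate hφ he n (two_ne_zero (α := ℝ)) (fun i => monomial (k i))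
  simp only [dilate_monomial] at h
  rw [MultilinearMap.map_smul_univ, Finset.prod_pow_eq_pow_sum, smul_eq_mul] at h
  by_contra hne
  exact hk (Nat.pow_right_injective le_rfl (by exact_mod_cast mul_right_cancel₀ hne h))

theorem derivForm_diag_eq_sum (hφ : IsFrechetSmooth φ) (he : IsAffineEquivariant φ) (n : ℕ)
    (f : SmoothFun) :
    derivForm hφ (n + 1) 0 0 (fun _ => f) =
      ∑ k : Fin (n + 1) → Fin (n + 2), if ∑ i, (k i : ℕ) = n then
        (∏ i, iteratedDeriv (k i) f 0 / (k i : ℕ).factorial) *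
          derivForm hφ (n + 1) 0 0 (fun i => monomial (k i)) else 0 := by
  obtain ⟨r, hr, hf⟩ := exists_contDiff_taylor_remainder (n + 1) f.contDiff
  set c : ℕ → ℝ := fun k => iteratedDeriv k f 0 / k.factorial with hc
  let ρ : ℝ → SmoothFun := fun ε => ⟨fun x => x ^ (n + 1) * r (ε * x), by
    apply ContDiff.contMDiff
    fun_prop⟩
  have hρ : Continuous ρ := continuous_of_contDiff
    (F := fun q : ℝ × ℝ => q.2 ^ (n + 1) * r (q.1 * q.2)) (by fun_prop) (fun p x => rfl)
  let g : ℝ → Fin (n + 2) → SmoothFun := fun ε k =>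
    if (k : ℕ) ≤ n then c k • monomial k else ρ ε
  have hg : ∀ k, Continuous fun ε => g ε k := fun k => by
    by_cases hk : (k : ℕ) ≤ n
    · simpa only [g, if_pos hk] using continuous_const
    · simpa only [g, if_neg hk] using hρ
  have hB : ∀ k : Fin (n + 1) → Fin (n + 2), Continuous fun ε =>
      derivForm hφ (n + 1) 0 0 (fun i => g ε (k i)) := fun k =>
    continuous_frechetIterDeriv_apply hφ (n + 1) 0 continuous_const
      (continuous_pi fun i => hg (k i))
  have hlow : ∀ (k : Fin (n + 1) → Fin (n + 2)) (ε : ℝ), ∑ i, (k i : ℕ) ≤ n →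
      derivForm hφ (n + 1) 0 0 (fun i => g ε (k i)) =
        (∏ i, c (k i)) * derivForm hφ (n + 1) 0 0 (fun i => monomial (k i)) := by
    intro k ε hk
    have : ∀ i, g ε (k i) = c (k i) • monomial (k i) := fun i => if_pos
      ((Finset.single_le_sum (f := fun i => (k i : ℕ)) (fun _ _ => Nat.zero_le _)
        (Finset.mem_univ i)).trans hk)
    simp only [this]
    rw [MultilinearMap.map_smul_univ, smul_eq_mul]
  have hdil : ∀ ε : ℝ, dilate ε f = ∑ k : Fin (n + 2), ε ^ (k : ℕ) • g ε k := by
    intro ε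
    ext x
    have hsum : (∑ k : Fin (n + 2), ε ^ (k : ℕ) • g ε k : SmoothFun) x =
        ∑ k : Fin (n + 2), ε ^ (k : ℕ) * g ε k x := by
      rw [← ContMDiffMap.coeFnAddMonoidHom_apply, map_sum, Finset.sum_apply]
      rfl
    rw [hsum, Fin.sum_univ_castSucc, dilate_apply, hf, Finset.sum_range]
    congr 1
    · refine Finset.sum_congr rfl fun k _ => ?_
      have : g ε k.castSucc = c k • monomial k := if_pos (Nat.lt_succ_iff.1 k.2)
      rw [this]
      simp [monomial_apply, hc]
      ring
    · have : g ε (Fin.last (n + 1)) = ρ ε := if_neg (by simp)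
      rw [this]
      simp [ρ, mul_pow, mul_assoc]
  have hexp : ∀ ε : ℝ, ε ≠ 0 → derivForm hφ (n + 1) 0 0 (fun _ => f) =
      ∑ k : Fin (n + 1) → Fin (n + 2), ε ^ (∑ i, (k i : ℕ)) / ε ^ n *
        derivForm hφ (n + 1) 0 0 (fun i => g ε (k i)) := by
    intro ε hε
    have h := derivForm_dilate hφ he n hε (fun _ => f)
    simp only [hdil] at h
    rw [MultilinearMap.map_sum] at h
    simp only [MultilinearMap.map_smul_univ, Finset.prod_pow_eq_pow_sum, smul_eq_mul] at h
    have hn : ε ^ n ≠ 0 := pow_ne_zero _ hε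
    rw [← mul_right_inj' hn, ← h, Finset.mul_sum]
    refine Finset.sum_congr rfl fun k _ => ?_
    field_simp
  refine tendsto_nhds_unique (l := 𝓝[≠] (0 : ℝ))
    (f := fun ε => ∑ k : Fin (n + 1) → Fin (n + 2), ε ^ (∑ i, (k i : ℕ)) / ε ^ n *
      derivForm hφ (n + 1) 0 0 (fun i => g ε (k i)))
    (tendsto_const_nhds.congr' ?_) (tendsto_finsetSum Finset.univ fun k _ => ?_)
  · filter_upwards [self_mem_nhdsWithin] with ε hε using hexp ε hε
  · rcases lt_trichotomy (∑ i, (k i : ℕ)) n with hk | hk | hk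
    · rw [if_neg hk.ne]
      simp only [hlow k _ hk.le, derivForm_monomial_eq_zero hφ he n hk.ne, mul_zero]
      exact tendsto_const_nhds
    · rw [if_pos hk]
      refine tendsto_const_nhds.congr' ?_
      filter_upwards [self_mem_nhdsWithin] with ε hε
      rw [hlow k _ hk.le, hk, div_self (pow_ne_zero _ hε), one_mul]
    · rw [if_neg hk.ne']
      have hlim : Filter.Tendsto (fun ε : ℝ => ε ^ (∑ i, (k i : ℕ) - n) *
          derivForm hφ (n + 1) 0 0 (fun i => g ε (k i))) (𝓝 0) (𝓝 0) := by
        have := ((continuous_pow (M := ℝ) (∑ i, (k i : ℕ) - n)).mul (hB k)).tendsto 0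
        simpa [zero_pow (Nat.sub_ne_zero_of_lt hk)] using! this
      refine (hlim.mono_left nhdsWithin_le_nhds).congr' ?_
      filter_upwards [self_mem_nhdsWithin] with ε hε
      rw [pow_sub₀ _ hε hk.le, div_eq_mul_inv]

/-- The Taylor term of order `n + 1` is a polynomial, homogeneous of total differential order `n`,
in the derivatives of the function. -/
theorem taylorTerm_succ_eq_sum (hφ : IsFrechetSmooth φ) (he : IsAffineEquivariant φ) (n : ℕ) :
    ∃ c : {k : Fin (n + 1) → Fin (n + 2) // ∑ i, (k i : ℕ) = n} → ℝ, ∀ (f : SmoothFun) (x : ℝ),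
      taylorTerm φ (n + 1) f x = ∑ k, c k * ∏ i, iteratedDeriv (k.1 i) f x := by
  refine ⟨fun k => ((n + 1).factorial : ℝ)⁻¹ * ((∏ i, ((k.1 i : ℕ).factorial : ℝ))⁻¹ *
    derivForm hφ (n + 1) 0 0 (fun i => monomial (k.1 i))), fun f x => ?_⟩
  have h := frechetIterDeriv_affineAct hφ he 1 (-x) (n + 1) 0 (fun _ => f) 0
  have h0 : affineAct 1 (-x) 0 = 0 := by
    ext y
    simp [affineAct_apply]
  have h1 : ∀ k, iteratedDeriv k (affineAct 1 (-x) f) 0 = iteratedDeriv k f x := by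
    intro k
    have : (affineAct 1 (-x) f : ℝ → ℝ) = fun y => f (y + x) := by
      funext y
      simp [affineAct_apply]
    rw [this, iteratedDeriv_comp_add_const]
    simp only [zero_add]
  have h2 : taylorTerm φ (n + 1) f x =
      ((n + 1).factorial : ℝ)⁻¹ * derivForm hφ (n + 1) 0 0 (fun _ => affineAct 1 (-x) f) := by
    rw [derivForm_apply, ← h0, h]
    simp [taylorTerm]
  rw [h2, derivForm_diag_eq_sum hφ he]
  simp only [h1]
  rw [← Finset.sum_filter, ← Finset.sum_subtype_eq_sum_filter, Finset.mul_sum]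
  simp only [Finset.subtype_univ]
  refine Finset.sum_congr rfl fun k _ => ?_
  rw [Finset.prod_div_distrib]
  ring

end SmoothFun

/-! ### Elementary differentials on the line -/

namespace AromaticForest

variable {n : ℕ}

theorem elementaryDifferential_lineBasis (γ : AromaticForest n) (f : ℝ → ℝ) (x : ℝ) :
    γ.elementaryDifferential lineBasis f x = ∏ v, iteratedDeriv (γ.parents v).card f x := by
  have h : ∀ ℓ v, γ.nodeFactor lineBasis f x ℓ v = iteratedDeriv (γ.parents v).card f x := by
    intro ℓ v
    simp [nodeFactor, lineBasis, iteratedDeriv_eq_iteratedFDeriv]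
  simp only [elementaryDifferential, h]
  simp [lineBasis]

theorem prod_parents_eq_finprod (γ : AromaticForest n) (h : ℕ → ℝ) :
    ∏ v, h (γ.parents v).card = ∏ᶠ j : ℕ, h j ^ γ.composition j := by
  rw [finprod_eq_prod_of_mulSupport_subset (s := Finset.univ.image fun v => (γ.parents v).card)]
  · exact (Finset.prod_comp h fun v => (γ.parents v).card)
  · intro j hj
    by_contra hne
    refine hj ?_
    have : γ.composition j = 0 := by
      rw [composition, Finset.card_eq_zero, Finset.filter_eq_empty_iff]
      intro v _ hv
      exact hne (by simp [← hv])
    simp [this]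

/-! ### Rooted trees with prescribed numbers of parents -/

theorem sum_card_parents (γ : AromaticForest n) : ∑ v, (γ.parents v).card = γ.arrows.card := by
  have : γ.arrows = Finset.univ.biUnion γ.parents := by
    ext u
    simp [arrows, parents, Option.isSome_iff_exists]
  rw [this, Finset.card_biUnion]
  intro v _ w _ hvw
  rw [Function.onFun, Finset.disjoint_left]
  intro u hu hu'
  simp only [parents, Finset.mem_filter, Finset.mem_univ, true_and] at hu hu'
  exact hvw (Option.some_injective _ (hu.symm.trans hu'))

/-- Every sequence of `n` natural numbers with sum `n - 1` is the sequence of numbers of parents of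
a forest in which the arrows decrease some height. -/
theorem exists_card_parents_eq (n : ℕ) (r : Fin n → ℕ) (hr : ∑ v, r v + 1 = n) :
    ∃ (γ : AromaticForest n) (ht : Fin n → ℕ), (∀ u w, γ u = some w → ht w < ht u) ∧
      ∀ v, (γ.parents v).card = r v := by
  induction n with
  | zero => omega
  | succ n ih =>
    rcases Nat.eq_zero_or_pos n with rfl | hn
    · refine ⟨fun _ => none, fun _ => 0, by simp, fun v => ?_⟩
      have : r v = 0 := by
        have := Finset.single_le_sum (f := r) (fun _ _ => Nat.zero_le _) (Finset.mem_univ v)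
        omega
      simp [parents, this]
    obtain ⟨i, hi⟩ : ∃ i, r i = 0 := by
      by_contra! h
      have : ∑ _v : Fin (n + 1), 1 ≤ ∑ v, r v :=
        Finset.sum_le_sum fun v _ => Nat.one_le_iff_ne_zero.2 (h v)
      rw [Finset.sum_const, Finset.card_univ, Fintype.card_fin, smul_eq_mul] at this
      omega
    rw [Fin.sum_univ_succAbove _ i, hi, zero_add] at hr
    obtain ⟨j, hj⟩ : ∃ j, r (i.succAbove j) ≠ 0 := by
      by_contra! h
      simp [h] at hr
      omega
    let r' : Fin n → ℕ := Function.update (fun v => r (i.succAbove v)) j (r (i.succAbove j) - 1)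
    have hr' : ∀ v, r (i.succAbove v) = r' v + if v = j then 1 else 0 := by
      intro v
      by_cases hv : v = j
      · subst hv
        simp [r']
        omega
      · simp [r', hv]
    have hsum : ∑ v, r (i.succAbove v) = ∑ v, r' v + 1 := by
      simp [hr', Finset.sum_add_distrib]
    obtain ⟨γ, ht, hlt, hcard⟩ := ih r' (by omega)
    let δ : AromaticForest (n + 1) :=
      i.insertNth (some (i.succAbove j)) fun u => (γ u).map i.succAbove
    have hδi : δ i = some (i.succAbove j) := by simp [δ]
    have hδ : ∀ u, δ (i.succAbove u) = (γ u).map i.succAbove := by simp [δ]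
    refine ⟨δ, i.insertNth (α := fun _ => ℕ) (ht j + 1) ht, fun u w huw => ?_, fun v => ?_⟩
    · induction u using Fin.succAboveCases i with
      | x =>
        rw [hδi, Option.some_inj] at huw
        subst huw
        simp
      | p u =>
        rw [hδ, Option.map_eq_some_iff] at huw
        obtain ⟨w, hw, rfl⟩ := huw
        simpa using hlt _ _ hw
    · have hcount : (δ.parents v).card = ∑ u, if δ u = some v then 1 else 0 := by
        rw [parents, Finset.card_filter]
      rw [hcount, Fin.sum_univ_succAbove _ i, hδi]
      simp only [hδ]
      induction v using Fin.succAboveCases i with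
      | x => simp [hi, Fin.succAbove_ne]
      | p v =>
        have : ∀ u, ((γ u).map i.succAbove = some (i.succAbove v)) ↔ γ u = some v := by
          intro u
          rw [← Option.map_some, (Option.map_injective Fin.succAbove_right_injective).eq_iff]
        simp only [this, Option.some_inj, Fin.succAbove_right_inj]
        rw [hr', ← hcard, parents, Finset.card_filter, add_comm]
        simp [eq_comm]

theorem exists_isRootedTree_card_parents_eq (n : ℕ) (r : Fin n → ℕ) (hr : ∑ v, r v + 1 = n) :
    ∃ γ : AromaticForest n, γ.IsRootedTree ∧ ∀ v, (γ.parents v).card = r v := by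
  obtain ⟨γ, ht, hlt, hcard⟩ := exists_card_parents_eq n r hr
  refine ⟨γ, ⟨?_, fun v hv => ?_⟩, hcard⟩
  · rw [IsAromaticTree, ← sum_card_parents]
    simpa [hcard] using hr
  · have key : ∀ u w, Relation.TransGen (fun u w => γ u = some w) u w → ht w < ht u := by
      intro u w h
      induction h with
      | single h => exact hlt _ _ h
      | tail _ h ih => exact (hlt _ _ h).trans ih
    exact lt_irrefl _ (key v v hv)

end AromaticForest

theorem ButcherTree.exists_elementaryDifferential_eq (n : ℕ) (r : Fin n → ℕ)
    (hr : ∑ v, r v + 1 = n) :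
    ∃ t : ButcherTree n, ∀ (f : ℝ → ℝ) (x : ℝ),
      t.elementaryDifferential f x = ∏ v, iteratedDeriv (r v) f x := by
  obtain ⟨γ, hγ, hcard⟩ := AromaticForest.exists_isRootedTree_card_parents_eq n r hr
  refine ⟨Quotient.mk (rootedTreeSetoid n) ⟨γ, hγ⟩, fun f x => ?_⟩
  refine (γ.elementaryDifferential_lineBasis f x).trans ?_
  simp only [hcard]

theorem SmoothFun.IsLocal.map_zero {φ : SmoothFun → SmoothFun} (hφ : SmoothFun.IsLocal φ) :
    φ 0 = 0 := by
  ext x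
  have h := hφ 0
  have h0 : tsupport (0 : SmoothFun) = ∅ := by
    rw [tsupport_eq_empty_iff]
    rfl
  rw [h0, Set.subset_empty_iff, tsupport_eq_empty_iff] at h
  exact congrFun h x

theorem mainTheorem5 :
    (∀ φ : SmoothFun → SmoothFun, IsFrechetSmooth φ → SmoothFun.IsLocal φ →
      SmoothFun.IsAffineEquivariant φ → IsBSeries (taylorTerm φ)) ∧
    (∀ (n : ℕ) (γ : AromaticForest n), γ.IsAromaticTree → ∀ (f : SmoothFun) (x : ℝ),
      γ.elementaryDifferential lineBasis f x =
        ∏ᶠ j : ℕ, (iteratedDeriv j f x) ^ γ.composition j) := by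
  classical
  refine ⟨fun φ hφ hl he => ?_, fun n γ _ f x => ?_⟩
  · have key : ∀ m : ℕ, ∃ b : ButcherTree m → ℝ, ∀ (f : SmoothFun) (x : ℝ),
        taylorTerm φ m f x = ∑ t : ButcherTree m, b t * t.elementaryDifferential f x := by
      rintro (_ | n)
      · refine ⟨0, fun f x => ?_⟩
        simp [taylorTerm, frechetIterDeriv, hl.map_zero]
      · obtain ⟨c, hc⟩ := SmoothFun.taylorTerm_succ_eq_sum hφ he n
        choose t ht using fun k : {k : Fin (n + 1) → Fin (n + 2) // ∑ i, (k i : ℕ) = n} =>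
          ButcherTree.exists_elementaryDifferential_eq (n + 1) (fun i => (k.1 i : ℕ)) (by rw [k.2])
        refine ⟨fun s => ∑ k with t k = s, c k, fun f x => ?_⟩
        rw [hc, ← Finset.sum_fiberwise (s := Finset.univ) t]
        refine Finset.sum_congr rfl fun s _ => ?_
        rw [Finset.sum_mul]
        refine Finset.sum_congr rfl fun k hk => ?_
        rw [← ht, (Finset.mem_filter.1 hk).2]
    choose b hb using key
    exact ⟨b, hb⟩
  · rw [γ.elementaryDifferential_lineBasis]
    exact γ.prod_parents_eq_finprod fun j => iteratedDeriv j f x
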